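/- Let $A$ (Alice's thermodynamic system) and $B$ (Bob's informational system) be finite-dimensional quantum systems, let $\rho_{AB}$ be a state of $AB$ and let $\gamma_A$ be a state of $A$ (the Gibbs state of its Hamiltonian), and let $\beta>0$ denote $1/(kT\ln 2)$, where $T$ is the temperature. For a system $R$ write $\pi_R=\mathbb 1_R/|R|$ (the Gibbs state of a trivial Hamiltonian) and $\Delta(\rho,\sigma)=\tfrac12\|\rho-\sigma\|_1$. A conditionally thermalization-covariant operation $(\mathcal N_{AB\to A'B'},\gamma_A,\gamma'_{A'})$ is a channel of the form $\mathcal N_{AB\to A'B'}=\mathcal F_{AB''\to A'}\circ\mathcal E_{B\to B'B''}$, with $B''$ a finite-dimensional system and $\mathcal E,\mathcal F$ channels, such that $\mathcal F[\gamma_A\otimes\sigma_{B''}]=\gamma'_{A'}$ for every state $\sigma_{B''}$. The one-shot work cost of erasing $A$ with error $\varepsilon\in[0,1]$, i.e. of converting $(\rho_{AB},\gamma_A)$ to a pure state $|0\rangle\langle 0|_A$ with trivial Hamiltonian, is $$W^\varepsilon_{\mathrm{eras}}(\rho_{AB},\gamma_A)=\frac1\beta\inf\Big\{\log_2|A_0|-\log_2|A_1|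 : \Delta\big(|0\rangle\langle0|_{A_1}\otimes|0\rangle\langle0|_A,\ \mathcal N[|0\rangle\langle0|_{A_0}\otimes\rho_{AB}]\big)\le\varepsilon\Big\},$$ where the infimum is over all finite-dimensional battery systems $A_0,A_1$ and all conditionally thermalization-covariant operations $(\mathcal N_{A_0AB\to A_1A},\pi_{A_0}\otimes\gamma_A,\pi_{A_1}\otimes\pi_A)$. The smoothed generalized min-mutual information is $$I_{\min}^{\downarrow,\varepsilon}(\rho_{AB}\|\gamma_A)=\inf_{\sigma_B}\ \sup_{\Lambda_{AB}}\big\{-\log_2\mathrm{Tr}[\Lambda_{AB}(\gamma_A\otimes\sigma_B)] : 0\le\Lambda_{AB}\le\mathbb 1,\ \mathrm{Tr}[\Lambda_{AB}\rho_{AB}]\ge1-\varepsilon\big\},$$ with $\sigma_B$ ranging over the states of $B$, and the generalized min-mutual information is $I_{\min}^{\downarrow}(\rho_{AB}\|\gamma_A)=\inf_{\sigma_B}\big(-\log_2\mathrm{Tr}[\rho_{AB}^0(\gamma_A\otimes\sigma_B)]\big)$, with $\rho_{AB}^0$ the projector onto the support of $\rho_{AB}$. All quantities take values in $[-\infty,+\infty]$,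 with $-\log_2 0=+\infty$. Then for every $\varepsilon\in[0,1]$ $$W^\varepsilon_{\mathrm{eras}}(\rho_{AB},\gamma_A)=\frac1\beta\Big(\log_2|A|-I_{\min}^{\downarrow,\varepsilon}(\rho_{AB}\|\gamma_A)\Big),$$ where $$I_{\min}^{\downarrow,\varepsilon}(\rho_{AB}\|\gamma_A)=\sup_{\Lambda_{AB}}\big\{-\log_2\|\mathrm{Tr}_A[\Lambda_{AB}\gamma_A]\|_\infty : 0\le\Lambda_{AB}\le\mathbb 1,\ \mathrm{Tr}[\Lambda_{AB}\rho_{AB}]\ge1-\varepsilon\big\}.$$ For $\varepsilon=0$ the work cost is $$W^0_{\mathrm{eras}}(\rho_{AB},\gamma_A)=\frac1\beta\Big(\log_2|A|-I_{\min}^{\downarrow}(\rho_{AB}\|\gamma_A)\Big),\qquad I_{\min}^{\downarrow}(\rho_{AB}\|\gamma_A)=-\log_2\|\mathrm{Tr}_A[\rho_{AB}^0\gamma_A]\|_\infty .$$ -/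

import Mathlib

open scoped Kronecker ComplexOrder MatrixOrder Matrix.Norms.L2Operator

/-! Finite-dimensional quantum systems are represented by finite index types: operators on a system
`A` are matrices `Matrix A A ℂ`, and the composite system `AB` has index type `A × B`.  The norm
`‖M‖` of a matrix is the operator norm for the Euclidean norm (the Schatten `∞`-norm). -/

namespace CondAthermality

noncomputable section

/-- `-log₂ x` for `x ≥ 0`, with the value `+∞` at `x = 0`. -/
def negLog2 (x : ℝ) : EReal :=
  if x ≤ 0 then ⊤ else ((-Real.logb 2 x : ℝ) : EReal)

/-- A quantum state: a positive semidefinite operator of trace one. -/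
def IsState {A : Type*} [Fintype A] (ρ : Matrix A A ℂ) : Prop :=
  ρ.PosSemidef ∧ ρ.trace = 1

/-- The pure state `|a⟩⟨a|` given by the basis vector `a`. -/
def pureState {A : Type*} [DecidableEq A] (a : A) : Matrix A A ℂ :=
  Matrix.single a a 1

/-- The uniform state `𝟙 / |A|`: the Gibbs state of the trivial Hamiltonian. -/
def uniformState (A : Type*) [Fintype A] [DecidableEq A] : Matrix A A ℂ :=
  ((Fintype.card A : ℂ)⁻¹) • (1 : Matrix A A ℂ)

/-- The partial trace `Tr_A` over the first tensor factor. -/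
def partialTraceA {A B : Type*} [Fintype A] (X : Matrix (A × B) (A × B) ℂ) : Matrix B B ℂ :=
  Matrix.of fun b b' => ∑ a, X (a, b) (a, b')

/-- The trace norm `‖X‖₁ = Tr |X|`, where `|X|` is the square root of `Xᴴ X`. -/
def traceNorm {A : Type*} [Fintype A] [DecidableEq A] (X : Matrix A A ℂ) : ℝ :=
  (CFC.abs X).trace.re

/-- The trace distance. -/
def traceDist {A : Type*} [Fintype A] [DecidableEq A] (ρ σ : Matrix A A ℂ) : ℝ :=
  (1 / 2) * traceNorm (ρ - σ)

/-- The projector `ρ⁰` onto the support of a Hermitian operator. -/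
def supportProj {A : Type*} [Fintype A] [DecidableEq A] (ρ : Matrix A A ℂ) : Matrix A A ℂ :=
  cfc (fun x : ℝ => if x = 0 then (0 : ℝ) else 1) ρ

/-- The map `id_K ⊗ N`: apply `N` to every block of an operator on `K × A`. -/
def ampl (K : Type*) {A B : Type*} (N : Matrix A A ℂ →ₗ[ℂ] Matrix B B ℂ)
    (X : Matrix (K × A) (K × A) ℂ) : Matrix (K × B) (K × B) ℂ :=
  Matrix.of fun i j => N (Matrix.of fun x y => X (i.1, x) (j.1, y)) i.2 j.2

/-- A quantum channel: a completely positive and trace-preserving linear map. -/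
def IsChannel {A B : Type*} [Fintype A] [Fintype B]
    (N : Matrix A A ℂ →ₗ[ℂ] Matrix B B ℂ) : Prop :=
  (∀ (k : ℕ) (X : Matrix (Fin k × A) (Fin k × A) ℂ), X.PosSemidef →
      (ampl (Fin k) N X).PosSemidef) ∧
    ∀ X : Matrix A A ℂ, (N X).trace = X.trace

/-- A conditionally thermalization-covariant operation `(N_{AB → A'B'}, γ_A, γ'_{A'})`: Bob applies
a channel `E_{B → B'B''}` and sends `B''` to Alice, who applies a channel `F_{AB'' → A'}` that turns
`γ_A ⊗ σ_{B''}` into `γ'_{A'}` for every state `σ_{B''}`. -/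
def IsFreeOperation {A B A' B' : Type*} [Fintype A] [Fintype B] [Fintype A'] [Fintype B']
    (N : Matrix (A × B) (A × B) ℂ →ₗ[ℂ] Matrix (A' × B') (A' × B') ℂ)
    (γ : Matrix A A ℂ) (γ' : Matrix A' A' ℂ) : Prop :=
  IsChannel N ∧
  ∃ (d : ℕ) (E : Matrix B B ℂ →ₗ[ℂ] Matrix (B' × Fin d) (B' × Fin d) ℂ)
    (F : Matrix (A × Fin d) (A × Fin d) ℂ →ₗ[ℂ] Matrix A' A' ℂ),
    IsChannel E ∧ IsChannel F ∧
    (∀ X : Matrix (A × B) (A × B) ℂ,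
      N X = (ampl B' F ((ampl A E X).submatrix
          (fun i : B' × (A × Fin d) => (i.2.1, (i.1, i.2.2)))
          (fun i : B' × (A × Fin d) => (i.2.1, (i.1, i.2.2))))).submatrix Prod.swap Prod.swap) ∧
    ∀ σ : Matrix (Fin d) (Fin d) ℂ, IsState σ → F (γ ⊗ₖ σ) = γ'

/-- Append a battery system `K` in the pure state `|0⟩⟨0|` to Alice's part of `AB`. -/
def withBattery (n : ℕ) {A B : Type*} (ρ : Matrix (A × B) (A × B) ℂ) :
    Matrix ((Fin (n + 1) × A) × B) ((Fin (n + 1) × A) × B) ℂ :=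
  (pureState (0 : Fin (n + 1)) ⊗ₖ ρ).submatrix (Equiv.prodAssoc _ _ _) (Equiv.prodAssoc _ _ _)

/-- The one-shot work cost `W^ε(ρ_{AB}, γ_A; σ_{A'B'}, γ'_{A'})` with `β = 1 / (k T ln 2)`.  The
infimum is over the battery systems `A₀`, `A₁`, of arbitrary dimensions `n₀ + 1`, `n₁ + 1` and with
trivial Hamiltonians, and over the free operations that realize the conversion up to error `ε`. -/
def workCost {A B A' B' : Type*} [Fintype A] [DecidableEq A] [Fintype B] [DecidableEq B]
    [Fintype A'] [DecidableEq A'] [Fintype B'] [DecidableEq B'] (β ε : ℝ)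
    (ρ : Matrix (A × B) (A × B) ℂ) (γ : Matrix A A ℂ)
    (σ : Matrix (A' × B') (A' × B') ℂ) (γ' : Matrix A' A' ℂ) : EReal :=
  ((1 / β : ℝ) : EReal) *
    ⨅ (n₀ : ℕ) (n₁ : ℕ)
      (N : Matrix ((Fin (n₀ + 1) × A) × B) ((Fin (n₀ + 1) × A) × B) ℂ →ₗ[ℂ]
        Matrix ((Fin (n₁ + 1) × A') × B') ((Fin (n₁ + 1) × A') × B') ℂ)
      (_ : IsFreeOperation N (uniformState (Fin (n₀ + 1)) ⊗ₖ γ)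
        (uniformState (Fin (n₁ + 1)) ⊗ₖ γ'))
      (_ : traceDist (withBattery n₁ σ) (N (withBattery n₀ ρ)) ≤ ε),
      ((Real.logb 2 ((n₀ : ℝ) + 1) - Real.logb 2 ((n₁ : ℝ) + 1) : ℝ) : EReal)

/-- The one-shot work cost of erasing `A`, with side information `B`, to the pure state `|a₀⟩⟨a₀|`
with trivial Hamiltonian; Bob's final system is trivial. -/
def erasureCost {A B : Type*} [Fintype A] [DecidableEq A] [Fintype B] [DecidableEq B] (β ε : ℝ)
    (ρ : Matrix (A × B) (A × B) ℂ) (γ : Matrix A A ℂ) (a₀ : A) : EReal :=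
  workCost β ε ρ γ (pureState a₀ ⊗ₖ (1 : Matrix Unit Unit ℂ)) (uniformState A)

/-- `Λ` is a test (`0 ≤ Λ ≤ 𝟙`) that accepts `ρ` with probability at least `1 - ε`. -/
def IsTest {R : Type*} [Fintype R] [DecidableEq R] (ε : ℝ) (ρ Λ : Matrix R R ℂ) : Prop :=
  Λ.PosSemidef ∧ (1 - Λ).PosSemidef ∧ 1 - ε ≤ (Λ * ρ).trace.re

/-- The smoothed min-relative entropy (hypothesis-testing relative entropy). -/
def smoothDmin {R : Type*} [Fintype R] [DecidableEq R] (ε : ℝ) (ρ σ : Matrix R R ℂ) : EReal :=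
  ⨆ (Λ : Matrix R R ℂ) (_ : IsTest ε ρ Λ), negLog2 (Λ * σ).trace.re

/-- The min-relative entropy `-log₂ Tr[ρ⁰ σ]`. -/
def Dmin {R : Type*} [Fintype R] [DecidableEq R] (ρ σ : Matrix R R ℂ) : EReal :=
  negLog2 (supportProj ρ * σ).trace.re

/-- The smoothed generalized min-mutual information `I_min^{↓,ε}(ρ_{AB} ‖ γ_A)`. -/
def smoothImin {A B : Type*} [Fintype A] [DecidableEq A] [Fintype B] [DecidableEq B] (ε : ℝ)
    (ρ : Matrix (A × B) (A × B) ℂ) (γ : Matrix A A ℂ) : EReal :=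
  ⨅ (σ : Matrix B B ℂ) (_ : IsState σ), smoothDmin ε ρ (γ ⊗ₖ σ)

/-- The generalized min-mutual information `I_min^↓(ρ_{AB} ‖ γ_A)`. -/
def Imin {A B : Type*} [Fintype A] [DecidableEq A] [Fintype B] [DecidableEq B]
    (ρ : Matrix (A × B) (A × B) ℂ) (γ : Matrix A A ℂ) : EReal :=
  ⨅ (σ : Matrix B B ℂ) (_ : IsState σ), Dmin ρ (γ ⊗ₖ σ)

end

end CondAthermality

open CondAthermality

/-! The smoothed information is the value of a zero-sum game: one player chooses a test `Λ` for `ρ`,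
the other a state `σ` of Bob, and the payoff is `Tr[Λ (γ ⊗ σ)] = Tr[K σ]`, where
`K = Tr_A[Λ γ] ≥ 0`. For fixed `Λ` the largest payoff is `‖K‖`. The sets of tests and of states are
compact and convex and the payoff is bilinear, so Sion's theorem provides a saddle point; this gives
the dual formula and an optimal test (`exists_isTest_smoothImin_eq`).

The work cost is matched with tests in both directions. From an erasure protocol, the pullback of
the target effect to `AB`, with the battery in `|0⟩⟨0|`, is a test. As `|0⟩⟨0| ≤ |A₀| π` and
the protocol maps `π ⊗ γ ⊗ σ` to the uniform state of `A₁A`, the payoff is at most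
`|A₀| / (|A₁| |A|)` whatever `σ` is (`negLog2_le_smoothImin`). Conversely, let `Λ` be a test with
`‖K‖ ≤ |A₀| / (|A₁| |A|)`. Alice receives all of `B`, performs `Λ` if the battery is in `|0⟩⟨0|` and
an effect `M` on `B` otherwise, prepares the target state on acceptance, and prepares the uniform
state on the orthogonal complement on rejection. The effect `M` is chosen so that the acceptance
probability on Gibbs states does not depend on `σ` and the output is uniform; the norm bound is what
makes `M ≥ 0` possible (`exists_isFreeOperation_traceDist_le`). Letting the battery dimensions grow,
`|A₀| / |A₁|` approaches `|A| ‖K‖` from above, which gives `erasureCost_eq`, including the value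
`-∞` when `K = 0`.

For `ε = 0`, every test dominates the support projector of `ρ`, which is itself a test, so the
smoothed and unsmoothed quantities agree (`smoothDmin_zero`). -/

namespace CondAthermality

/-! ### Positivity and traces -/

section Positivity

variable {R : Type*} [Fintype R]

lemma exists_conjTranspose_mul_self {M : Matrix R R ℂ} (hM : M.PosSemidef) :
    ∃ C : Matrix R R ℂ, M = C.conjTranspose * C := by
  classical
  obtain ⟨C, hC⟩ := CStarAlgebra.nonneg_iff_eq_star_mul_self.mp
    (Matrix.nonneg_iff_posSemidef.mpr hM)
  exact ⟨C, hC⟩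

lemma trace_mul_nonneg {M N : Matrix R R ℂ} (hM : M.PosSemidef) (hN : N.PosSemidef) :
    0 ≤ (M * N).trace := by
  obtain ⟨C, rfl⟩ := exists_conjTranspose_mul_self hM
  rw [Matrix.mul_assoc, Matrix.trace_mul_comm]
  exact (hN.mul_mul_conjTranspose_same C).trace_nonneg

lemma re_trace_mul_nonneg {M N : Matrix R R ℂ} (hM : M.PosSemidef) (hN : N.PosSemidef) :
    0 ≤ (M * N).trace.re :=
  (Complex.nonneg_iff.mp (trace_mul_nonneg hM hN)).1

lemma trace_eq_re {M N : Matrix R R ℂ} (hM : M.PosSemidef) (hN : N.PosSemidef) :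
    (M * N).trace = ((M * N).trace.re : ℂ) := by
  have := Complex.nonneg_iff.mp (trace_mul_nonneg hM hN)
  apply Complex.ext <;> simp [← this.2]

lemma mul_eq_zero_of_trace_mul_eq_zero {M N : Matrix R R ℂ} (hM : M.PosSemidef)
    (hN : N.PosSemidef) (h : (M * N).trace = 0) : M * N = 0 := by
  obtain ⟨C, rfl⟩ := exists_conjTranspose_mul_self hM
  obtain ⟨D, rfl⟩ := exists_conjTranspose_mul_self hN
  have h' : ((C * D.conjTranspose) * (C * D.conjTranspose).conjTranspose).trace = 0 := by
    rw [← h, Matrix.conjTranspose_mul, Matrix.conjTranspose_conjTranspose,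
      Matrix.trace_mul_comm, Matrix.mul_assoc, Matrix.trace_mul_comm]
    simp only [Matrix.mul_assoc]
  rw [Matrix.trace_mul_conjTranspose_self_eq_zero_iff] at h'
  calc C.conjTranspose * C * (D.conjTranspose * D)
      = C.conjTranspose * (C * D.conjTranspose) * D := by simp only [Matrix.mul_assoc]
    _ = 0 := by simp [h']

/-- Self-duality of the positive cone. `M` is not assumed Hermitian: over `ℂ` that follows from the
reality of its quadratic form. -/
lemma posSemidef_of_trace_mul_nonneg {M : Matrix R R ℂ}
    (h : ∀ X : Matrix R R ℂ, X.PosSemidef → 0 ≤ (M * X).trace) : M.PosSemidef := by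
  classical
  have key (x : R → ℂ) : 0 ≤ star x ⬝ᵥ M.mulVec x := by
    have := h _ (Matrix.posSemidef_vecMulVec_self_star x)
    rwa [Matrix.mul_vecMulVec, Matrix.trace_vecMulVec, dotProduct_comm] at this
  rw [← Matrix.isPositive_toEuclideanLin_iff, LinearMap.isPositive_iff_complex]
  intro x
  have hx := Complex.nonneg_iff.mp (key (WithLp.ofLp x))
  have e : inner ℂ (M.toEuclideanLin x) x = star (star (WithLp.ofLp x) ⬝ᵥ M.mulVec x.ofLp) := by
    rw [EuclideanSpace.inner_eq_star_dotProduct, ← Matrix.star_dotProduct_star, star_star,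
      dotProduct_comm]
    rfl
  rw [e]
  constructor
  · apply Complex.ext <;> simp [← hx.2]
  · simpa using hx.1

/-- For a Hermitian operator, positivity can be tested on normalized states. -/
lemma posSemidef_of_re_trace_mul_nonneg {M : Matrix R R ℂ} (hM : M.IsHermitian)
    (h : ∀ σ : Matrix R R ℂ, IsState σ → 0 ≤ (M * σ).trace.re) : M.PosSemidef := by
  refine posSemidef_of_trace_mul_nonneg fun X hX => ?_
  have him : (M * X).trace.im = 0 := by
    rw [← Complex.conj_eq_iff_im]
    calc star (M * X).trace = ((M * X).conjTranspose).trace := (Matrix.trace_conjTranspose _).symm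
      _ = (M * X).trace := by
        rw [Matrix.conjTranspose_mul, hM.eq, hX.1.eq, Matrix.trace_mul_comm]
  rcases eq_or_ne X.trace 0 with h0 | h0
  · rw [hX.trace_eq_zero_iff.mp h0]; simp
  · have hpos : 0 < X.trace.re := by
      have := Complex.nonneg_iff.mp hX.trace_nonneg
      refine lt_of_le_of_ne this.1 fun hz => h0 (Complex.ext hz.symm this.2.symm)
    have htr : X.trace = (X.trace.re : ℂ) :=
      Complex.ext rfl (Complex.nonneg_iff.mp hX.trace_nonneg).2.symm
    have hs : IsState ((X.trace.re⁻¹ : ℝ) • X) := by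
      refine ⟨hX.smul (inv_nonneg.mpr hpos.le), ?_⟩
      rw [Matrix.trace_smul]
      nth_rw 2 [htr]
      rw [Complex.real_smul, ← Complex.ofReal_mul, inv_mul_cancel₀ hpos.ne', Complex.ofReal_one]
    have := h _ hs
    rw [Matrix.mul_smul, Matrix.trace_smul, Complex.real_smul, Complex.re_ofReal_mul] at this
    exact Complex.nonneg_iff.mpr
      ⟨nonneg_of_mul_nonneg_right this (inv_pos.mpr hpos), him.symm⟩

end Positivity

/-! ### The operator norm of a positive operator -/

section Norm

variable {R : Type*} [Fintype R] [DecidableEq R]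

lemma norm_le_iff_posSemidef {K : Matrix R R ℂ} (hK : K.PosSemidef) {t : ℝ} (ht : 0 ≤ t) :
    ‖K‖ ≤ t ↔ ((t : ℂ) • (1 : Matrix R R ℂ) - K).PosSemidef := by
  rw [CStarAlgebra.norm_le_iff_le_algebraMap K ht (Matrix.nonneg_iff_posSemidef.mpr hK),
    Matrix.le_iff]
  congr! 2
  rw [Algebra.algebraMap_eq_smul_one]
  ext i j; simp

lemma re_trace_smul_one_sub_mul (K σ : Matrix R R ℂ) (hσ : IsState σ) (t : ℝ) :
    (((t : ℂ) • (1 : Matrix R R ℂ) - K) * σ).trace.re = t - (K * σ).trace.re := by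
  simp [Matrix.sub_mul, Matrix.trace_sub, Matrix.trace_smul, hσ.2]

/-- Together with `norm_le_of_re_trace_mul_le` this is the variational formula
`‖K‖ = max_σ Tr[K σ]` over states, for `K ≥ 0`. -/
lemma re_trace_mul_le_norm {K σ : Matrix R R ℂ} (hK : K.PosSemidef) (hσ : IsState σ) :
    (K * σ).trace.re ≤ ‖K‖ := by
  have := re_trace_mul_nonneg ((norm_le_iff_posSemidef hK (norm_nonneg K)).mp le_rfl) hσ.1
  rw [re_trace_smul_one_sub_mul K σ hσ] at this
  linarith

lemma norm_le_of_re_trace_mul_le {K : Matrix R R ℂ} (hK : K.PosSemidef) {t : ℝ} (ht : 0 ≤ t)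
    (h : ∀ σ : Matrix R R ℂ, IsState σ → (K * σ).trace.re ≤ t) : ‖K‖ ≤ t := by
  rw [norm_le_iff_posSemidef hK ht]
  refine posSemidef_of_re_trace_mul_nonneg ?_ fun σ hσ => ?_
  · refine Matrix.IsHermitian.sub ?_ hK.1
    simp [Matrix.IsHermitian, Matrix.conjTranspose_smul]
  · rw [re_trace_smul_one_sub_mul K σ hσ]
    linarith [h σ hσ]

end Norm

/-! ### States and basis states -/

section Compact

variable {R : Type*} [Fintype R] [DecidableEq R]

lemma isClosed_setOf_posSemidef : IsClosed {M : Matrix R R ℂ | M.PosSemidef} := by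
  have : {M : Matrix R R ℂ | M.PosSemidef} = Set.Ici 0 := by
    ext M; simp [Matrix.nonneg_iff_posSemidef]
  rw [this]
  exact isClosed_Ici

omit [Fintype R] [DecidableEq R] in
lemma convex_setOf_posSemidef : Convex ℝ {M : Matrix R R ℂ | M.PosSemidef} :=
  fun _ hM _ hN _ _ ha hb _ => (hM.smul ha).add (hN.smul hb)

lemma isCompact_setOf_posSemidef_le_one :
    IsCompact {M : Matrix R R ℂ | M.PosSemidef ∧ (1 - M).PosSemidef} := by
  refine Metric.isCompact_of_isClosed_isBounded ?_ ?_
  · exact isClosed_setOf_posSemidef.inter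
      (isClosed_setOf_posSemidef.preimage (continuous_const.sub continuous_id))
  · refine (Metric.isBounded_closedBall (x := 0) (r := 1)).subset fun M hM => ?_
    rw [mem_closedBall_zero_iff, norm_le_iff_posSemidef hM.1 zero_le_one]
    simpa using hM.2

omit [DecidableEq R] in
lemma IsState.nonempty {σ : Matrix R R ℂ} (hσ : IsState σ) : Nonempty R := by
  by_contra h
  rw [not_nonempty_iff] at h
  have := hσ.2
  simp [Matrix.trace] at this

lemma IsState.norm_le_one {σ : Matrix R R ℂ} (hσ : IsState σ) : ‖σ‖ ≤ 1 := by
  have := hσ.nonempty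
  have hmem := CStarAlgebra.norm_mem_spectrum_of_nonneg (a := σ)
    (Matrix.nonneg_iff_posSemidef.mpr hσ.1)
  rw [hσ.1.1.spectrum_real_eq_range_eigenvalues] at hmem
  obtain ⟨i, hi⟩ := hmem
  have htr : ∑ i, hσ.1.1.eigenvalues i = 1 := by
    simpa using congrArg Complex.re (hσ.1.1.trace_eq_sum_eigenvalues.symm.trans hσ.2)
  rw [← hi, ← htr]
  exact Finset.single_le_sum (fun j _ => hσ.1.eigenvalues_nonneg j) (Finset.mem_univ i)

omit [DecidableEq R] in
lemma convex_setOf_isState : Convex ℝ {σ : Matrix R R ℂ | IsState σ} := by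
  intro σ hσ τ hτ a b ha hb hab
  refine ⟨convex_setOf_posSemidef hσ.1 hτ.1 ha hb hab, ?_⟩
  rw [Matrix.trace_add, Matrix.trace_smul, Matrix.trace_smul, hσ.2, hτ.2, ← add_smul, hab,
    one_smul]

lemma isCompact_setOf_isState : IsCompact {σ : Matrix R R ℂ | IsState σ} := by
  refine Metric.isCompact_of_isClosed_isBounded ?_ ?_
  · exact isClosed_setOf_posSemidef.inter
      (isClosed_singleton.preimage (f := Matrix.trace) (continuous_id.matrix_trace))
  · exact (Metric.isBounded_closedBall (x := 0) (r := 1)).subset fun σ hσ =>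
      mem_closedBall_zero_iff.mpr (IsState.norm_le_one hσ)

lemma isState_pureState (a : R) : IsState (pureState a) := by
  refine ⟨?_, by simp [pureState]⟩
  have h : pureState a = Matrix.diagonal (Pi.single a (1 : ℂ)) := by
    rw [pureState, Matrix.diagonal_single]
  rw [h, Matrix.posSemidef_diagonal_iff]
  intro i
  by_cases h : i = a
  · subst h; simp
  · simp [h]

omit [Fintype R] in
lemma one_sub_pureState_posSemidef (a : R) : (1 - pureState a).PosSemidef := by
  have h : (1 - pureState a : Matrix R R ℂ) = Matrix.diagonal (1 - Pi.single a (1 : ℂ)) := by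
    rw [pureState, ← Matrix.diagonal_single, ← Matrix.diagonal_one, Matrix.diagonal_sub]
    rfl
  rw [h, Matrix.posSemidef_diagonal_iff]
  intro i
  by_cases h : i = a
  · subst h; simp
  · simp [h]

lemma setOf_isState_nonempty [Nonempty R] : {σ : Matrix R R ℂ | IsState σ}.Nonempty :=
  ⟨_, isState_pureState (Classical.arbitrary R)⟩

omit [DecidableEq R] in
lemma isState_kronecker {S : Type*} [Fintype S] {ρ : Matrix R R ℂ} {σ : Matrix S S ℂ}
    (hρ : IsState ρ) (hσ : IsState σ) : IsState (ρ ⊗ₖ σ) := by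
  classical
  exact ⟨hρ.1.kronecker hσ.1, by rw [Matrix.trace_kronecker, hρ.2, hσ.2, one_mul]⟩

lemma exists_isState_re_trace_mul_eq_norm [Nonempty R] {K : Matrix R R ℂ} (hK : K.PosSemidef) :
    ∃ σ : Matrix R R ℂ, IsState σ ∧ (K * σ).trace.re = ‖K‖ := by
  have hc : Continuous fun σ : Matrix R R ℂ => (K * σ).trace.re :=
    Complex.continuous_re.comp (continuous_const.matrix_mul continuous_id).matrix_trace
  obtain ⟨σ, hσ, hmax⟩ := isCompact_setOf_isState.exists_isMaxOn setOf_isState_nonempty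
    hc.continuousOn
  refine ⟨σ, hσ, le_antisymm (re_trace_mul_le_norm hK hσ) ?_⟩
  exact norm_le_of_re_trace_mul_le hK (re_trace_mul_nonneg hK hσ.1) fun τ hτ => hmax hτ

end Compact

/-! ### The partial trace against a product operator -/

section PartialTrace

variable {A B : Type*} [Fintype A] [Fintype B] [DecidableEq B]

/-- `partialTraceA (Λ * (γ ⊗ₖ 1))` represents the linear functional `σ ↦ Tr[Λ (γ ⊗ σ)]` on Bob's
operators; this is the only property of it that matters. -/
lemma trace_partialTraceA_mul (Λ : Matrix (A × B) (A × B) ℂ) (γ : Matrix A A ℂ)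
    (σ : Matrix B B ℂ) :
    (partialTraceA (Λ * (γ ⊗ₖ (1 : Matrix B B ℂ))) * σ).trace = (Λ * (γ ⊗ₖ σ)).trace := by
  classical
  have h : (γ ⊗ₖ σ) = (γ ⊗ₖ (1 : Matrix B B ℂ)) * ((1 : Matrix A A ℂ) ⊗ₖ σ) := by
    rw [← Matrix.mul_kronecker_mul, Matrix.mul_one, Matrix.one_mul]
  rw [h, ← Matrix.mul_assoc]
  generalize Λ * (γ ⊗ₖ (1 : Matrix B B ℂ)) = Y
  simp only [Matrix.trace, Matrix.diag, Matrix.mul_apply, partialTraceA, Matrix.of_apply,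
    Fintype.sum_prod_type, Matrix.kroneckerMap_apply, Matrix.one_apply, ite_mul, one_mul,
    zero_mul, mul_ite, mul_zero, Finset.sum_mul]
  simp only [Finset.sum_ite_eq', Finset.sum_ite_irrel, Finset.sum_const_zero, Finset.mem_univ,
    if_true]
  exact Finset.sum_comm_cycle

lemma partialTraceA_posSemidef {Λ : Matrix (A × B) (A × B) ℂ} (hΛ : Λ.PosSemidef)
    {γ : Matrix A A ℂ} (hγ : γ.PosSemidef) :
    (partialTraceA (Λ * (γ ⊗ₖ (1 : Matrix B B ℂ)))).PosSemidef := by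
  classical
  refine posSemidef_of_trace_mul_nonneg fun X hX => ?_
  rw [trace_partialTraceA_mul]
  exact trace_mul_nonneg hΛ (hγ.kronecker hX)

end PartialTrace

lemma negLog2_antitone : Antitone negLog2 := by
  intro x y hxy
  unfold negLog2
  split_ifs with h1 h2 h2
  · exact le_rfl
  · exact absurd (hxy.trans h1) h2
  · exact le_top
  · rw [not_le] at h1 h2
    exact_mod_cast neg_le_neg (Real.logb_le_logb_of_le one_lt_two h2 hxy)

/-! ### The minimax formula for the smoothed information -/

section Minimax

variable {A B : Type*} [Fintype A] [DecidableEq A] [Fintype B] [DecidableEq B]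

lemma convex_setOf_isTest {R : Type*} [Fintype R] [DecidableEq R] (ε : ℝ) (ρ : Matrix R R ℂ) :
    Convex ℝ {Λ | IsTest ε ρ Λ} := by
  intro Λ hΛ Λ' hΛ' a b ha hb hab
  refine ⟨convex_setOf_posSemidef hΛ.1 hΛ'.1 ha hb hab, ?_, ?_⟩
  · have : 1 - (a • Λ + b • Λ') = a • (1 - Λ) + b • (1 - Λ') := by
      rw [smul_sub, smul_sub, sub_add_sub_comm, ← add_smul, hab, one_smul]
    rw [this]
    exact convex_setOf_posSemidef hΛ.2.1 hΛ'.2.1 ha hb hab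
  · have h1 := hΛ.2.2
    have h2 := hΛ'.2.2
    rw [Matrix.add_mul, Matrix.smul_mul, Matrix.smul_mul, Matrix.trace_add, Matrix.trace_smul,
      Matrix.trace_smul, Complex.add_re, Complex.smul_re, Complex.smul_re, smul_eq_mul, smul_eq_mul]
    have : b = 1 - a := by linarith
    subst this
    nlinarith [mul_le_mul_of_nonneg_left h1 ha, mul_le_mul_of_nonneg_left h2 hb]

lemma isCompact_setOf_isTest {R : Type*} [Fintype R] [DecidableEq R] (ε : ℝ)
    (ρ : Matrix R R ℂ) : IsCompact {Λ | IsTest ε ρ Λ} := by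
  have hc : Continuous fun Λ : Matrix R R ℂ => (Λ * ρ).trace.re :=
    Complex.continuous_re.comp (continuous_id.matrix_mul continuous_const).matrix_trace
  have : {Λ | IsTest ε ρ Λ} = {M : Matrix R R ℂ | M.PosSemidef ∧ (1 - M).PosSemidef} ∩
      {Λ | 1 - ε ≤ (Λ * ρ).trace.re} := by
    ext Λ; simp [IsTest, and_assoc]
  rw [this]
  exact isCompact_setOf_posSemidef_le_one.inter_right (isClosed_le continuous_const hc)

/-- Sion's theorem for the bilinear function `Tr[Λ (γ ⊗ σ)]` on the compact convex sets of tests and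
of states. -/
lemma exists_isTest_isState_saddle {ε : ℝ} (hε : 0 ≤ ε) {ρ : Matrix (A × B) (A × B) ℂ}
    (hρ : IsState ρ) (γ : Matrix A A ℂ) :
    ∃ Λ, IsTest ε ρ Λ ∧ ∃ σ : Matrix B B ℂ, IsState σ ∧ ∀ Λ', IsTest ε ρ Λ' →
      ∀ σ', IsState σ' → (Λ * (γ ⊗ₖ σ')).trace.re ≤ (Λ' * (γ ⊗ₖ σ)).trace.re := by
  have : Nonempty B := hρ.nonempty.map Prod.snd
  let f : Matrix (A × B) (A × B) ℂ →ₗ[ℝ] Matrix B B ℂ →ₗ[ℝ] ℝ :=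
    LinearMap.mk₂ ℝ (fun Λ σ => (Λ * (γ ⊗ₖ σ)).trace.re)
      (fun _ _ _ => by simp [Matrix.add_mul])
      (fun _ _ _ => by simp)
      (fun _ _ _ => by simp [Matrix.kronecker_add, Matrix.mul_add])
      (fun _ _ _ => by simp [Matrix.kronecker_smul])
  have hfc (σ : Matrix B B ℂ) : Continuous fun Λ => f Λ σ :=
    (f.flip σ).continuous_of_finiteDimensional
  have hfc' (Λ) : Continuous fun σ : Matrix B B ℂ => f Λ σ :=
    (f Λ).continuous_of_finiteDimensional
  obtain ⟨Λ, hΛ, σ, hσ, h⟩ := Sion.exists_isSaddlePointOn (X := {Λ | IsTest ε ρ Λ})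
    (Y := {σ : Matrix B B ℂ | IsState σ}) (f := fun Λ σ => f Λ σ)
    ⟨1, Matrix.PosSemidef.one, by simpa using Matrix.PosSemidef.zero, by simp [hρ.2, hε]⟩
    (convex_setOf_isTest ε ρ) (isCompact_setOf_isTest ε ρ)
    (fun σ _ => (hfc σ).lowerSemicontinuous.lowerSemicontinuousOn _)
    (fun σ _ => ((f.flip σ).convexOn (convex_setOf_isTest ε ρ)).quasiconvexOn)
    convex_setOf_isState setOf_isState_nonempty isCompact_setOf_isState
    (fun Λ _ => (hfc' Λ).upperSemicontinuous.upperSemicontinuousOn _)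
    (fun Λ _ => ((f Λ).concaveOn convex_setOf_isState).quasiconcaveOn)
  exact ⟨Λ, hΛ, σ, hσ, fun Λ' hΛ' σ' hσ' => h Λ' hΛ' σ' hσ'⟩

/-- The supremum over tests that computes `smoothImin` is attained, by the saddle-point test. -/
lemma exists_isTest_smoothImin_eq {ε : ℝ} (hε : 0 ≤ ε) {ρ : Matrix (A × B) (A × B) ℂ}
    (hρ : IsState ρ) {γ : Matrix A A ℂ} (hγ : γ.PosSemidef) :
    ∃ Λ, IsTest ε ρ Λ ∧
      smoothImin ε ρ γ = negLog2 ‖partialTraceA (Λ * (γ ⊗ₖ (1 : Matrix B B ℂ)))‖ ∧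
      smoothImin ε ρ γ = ⨆ (Λ : Matrix (A × B) (A × B) ℂ) (_ : IsTest ε ρ Λ),
            negLog2 ‖partialTraceA (Λ * (γ ⊗ₖ (1 : Matrix B B ℂ)))‖ := by
  obtain ⟨Λ, hΛ, σ, hσ, h⟩ := exists_isTest_isState_saddle hε hρ γ
  -- This direction is weak duality; the saddle point gives the other one.
  have hge : ⨆ (Λ : Matrix (A × B) (A × B) ℂ) (_ : IsTest ε ρ Λ),
      negLog2 ‖partialTraceA (Λ * (γ ⊗ₖ (1 : Matrix B B ℂ)))‖ ≤ smoothImin ε ρ γ := by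
    refine iSup₂_le fun Λ' hΛ' => le_iInf₂ fun σ' hσ' => ?_
    refine le_trans (negLog2_antitone ?_) (le_iSup₂ (f := fun (Λ : Matrix (A × B) (A × B) ℂ)
      (_ : IsTest ε ρ Λ) => negLog2 (Λ * (γ ⊗ₖ σ')).trace.re) Λ' hΛ')
    rw [← trace_partialTraceA_mul]
    exact re_trace_mul_le_norm (partialTraceA_posSemidef hΛ'.1 hγ) hσ'
  have hle : smoothImin ε ρ γ ≤
      negLog2 ‖partialTraceA (Λ * (γ ⊗ₖ (1 : Matrix B B ℂ)))‖ := by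
    refine le_trans (iInf₂_le σ hσ) (iSup₂_le fun Λ' hΛ' => negLog2_antitone ?_)
    refine norm_le_of_re_trace_mul_le (partialTraceA_posSemidef hΛ.1 hγ)
      (re_trace_mul_nonneg hΛ'.1 (hγ.kronecker hσ.1)) fun τ hτ => ?_
    rw [trace_partialTraceA_mul]
    exact h Λ' hΛ' τ hτ
  have hsup := le_iSup₂ (f := fun (Λ : Matrix (A × B) (A × B) ℂ)
      (_ : IsTest ε ρ Λ) => negLog2 ‖partialTraceA (Λ * (γ ⊗ₖ (1 : Matrix B B ℂ)))‖) Λ hΛ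
  exact ⟨Λ, hΛ, le_antisymm hle (hsup.trans hge), le_antisymm (hle.trans hsup) hge⟩

end Minimax

/-! ### Tests of zero error and the support projector -/

section SupportProj

variable {R : Type*} [Fintype R] [DecidableEq R]

lemma supportProj_posSemidef (ρ : Matrix R R ℂ) : (supportProj ρ).PosSemidef := by
  rw [← Matrix.nonneg_iff_posSemidef]
  exact cfc_nonneg fun x _ => by split_ifs <;> simp

lemma one_sub_supportProj_posSemidef (ρ : Matrix R R ℂ) : (1 - supportProj ρ).PosSemidef := by
  rw [← Matrix.le_iff]
  exact cfc_le_one _ _ fun x _ => by split_ifs <;> simp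

lemma continuousOn_spectrum (ρ : Matrix R R ℂ) (f : ℝ → ℝ) : ContinuousOn f (spectrum ℝ ρ) :=
  (Matrix.finite_real_spectrum (A := ρ)).continuousOn f

lemma supportProj_eq_mul {ρ : Matrix R R ℂ} (hρ : ρ.IsHermitian) :
    supportProj ρ = ρ * cfc (fun x : ℝ => x⁻¹) ρ := by
  have hs : IsSelfAdjoint ρ := hρ
  -- With the convention `0⁻¹ = 0`, `x * x⁻¹` is the indicator function of `x ≠ 0`.
  nth_rw 2 [← cfc_id' ℝ ρ]
  rw [← cfc_mul _ _ ρ (continuousOn_spectrum ρ _) (continuousOn_spectrum ρ _)]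
  refine cfc_congr fun x _ => ?_
  by_cases h : x = 0 <;> simp [h]

lemma supportProj_mul_self {ρ : Matrix R R ℂ} (hρ : ρ.IsHermitian) :
    supportProj ρ * ρ = ρ := by
  have hs : IsSelfAdjoint ρ := hρ
  nth_rw 2 [← cfc_id' ℝ ρ]
  nth_rw 3 [← cfc_id' ℝ ρ]
  rw [supportProj, ← cfc_mul _ _ ρ (continuousOn_spectrum ρ _) (continuousOn_spectrum ρ _)]
  refine cfc_congr fun x _ => ?_
  by_cases h : x = 0 <;> simp [h]

lemma supportProj_idem (ρ : Matrix R R ℂ) :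
    supportProj ρ * supportProj ρ = supportProj ρ := by
  rw [supportProj, ← cfc_mul _ _ ρ (continuousOn_spectrum ρ _) (continuousOn_spectrum ρ _)]
  refine cfc_congr fun x _ => ?_
  by_cases h : x = 0 <;> simp [h]

lemma isTest_supportProj {ρ : Matrix R R ℂ} (hρ : IsState ρ) : IsTest 0 ρ (supportProj ρ) :=
  ⟨supportProj_posSemidef ρ, one_sub_supportProj_posSemidef ρ, by
    simp [supportProj_mul_self hρ.1.1, hρ.2]⟩

/-- A test that accepts `ρ` with certainty fixes the support of `ρ`, hence dominates its projector:
`Λ = ρ⁰ + (1 - ρ⁰) Λ (1 - ρ⁰)`. -/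
lemma IsTest.sub_supportProj_posSemidef {ρ Λ : Matrix R R ℂ} (hρ : IsState ρ)
    (hΛ : IsTest 0 ρ Λ) : (Λ - supportProj ρ).PosSemidef := by
  have hz : (1 - Λ) * ρ = 0 := by
    refine mul_eq_zero_of_trace_mul_eq_zero hΛ.2.1 hρ.1 ?_
    have h1 := re_trace_mul_nonneg hΛ.2.1 hρ.1
    rw [trace_eq_re hΛ.2.1 hρ.1, ← Complex.ofReal_zero]
    congr 1
    refine le_antisymm ?_ h1
    have := hΛ.2.2
    simp only [Matrix.sub_mul, Matrix.one_mul, Matrix.trace_sub, hρ.2, Complex.sub_re,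
      Complex.one_re]
    linarith
  have hP : Λ * supportProj ρ = supportProj ρ := by
    have : (1 - Λ) * supportProj ρ = 0 := by
      rw [supportProj_eq_mul hρ.1.1, ← Matrix.mul_assoc, hz, Matrix.zero_mul]
    rw [Matrix.sub_mul, Matrix.one_mul, sub_eq_zero] at this
    exact this.symm
  have hP' : supportProj ρ * Λ = supportProj ρ := by
    have := congrArg Matrix.conjTranspose hP
    rwa [Matrix.conjTranspose_mul, hΛ.1.1.eq, (supportProj_posSemidef ρ).1.eq] at this
  have key : Λ - supportProj ρ = (1 - supportProj ρ) * Λ * (1 - supportProj ρ).conjTranspose := by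
    rw [(one_sub_supportProj_posSemidef ρ).1.eq]
    simp only [Matrix.sub_mul, Matrix.mul_sub, Matrix.one_mul, Matrix.mul_one, hP, hP',
      supportProj_idem]
    abel
  rw [key]
  exact hΛ.1.mul_mul_conjTranspose_same _

/-- The support projector is the optimal test of zero error. -/
lemma smoothDmin_zero {ρ σ : Matrix R R ℂ} (hρ : IsState ρ) (hσ : σ.PosSemidef) :
    smoothDmin 0 ρ σ = Dmin ρ σ := by
  refine le_antisymm (iSup₂_le fun Λ hΛ => negLog2_antitone ?_) ?_
  · have := re_trace_mul_nonneg (hΛ.sub_supportProj_posSemidef hρ) hσ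
    rw [Matrix.sub_mul, Matrix.trace_sub, Complex.sub_re] at this
    linarith
  · exact le_iSup₂ (f := fun (Λ : Matrix R R ℂ) (_ : IsTest 0 ρ Λ) =>
      negLog2 (Λ * σ).trace.re) _ (isTest_supportProj hρ)

end SupportProj

/-! ### The information without smoothing -/

section Unsmoothed

variable {A B : Type*} [Fintype A] [DecidableEq A] [Fintype B] [DecidableEq B]

lemma smoothImin_zero {ρ : Matrix (A × B) (A × B) ℂ} (hρ : IsState ρ) {γ : Matrix A A ℂ}
    (hγ : γ.PosSemidef) : smoothImin 0 ρ γ = Imin ρ γ :=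
  iInf_congr fun _ => iInf_congr fun hσ => smoothDmin_zero hρ (hγ.kronecker hσ.1)

lemma Imin_eq_negLog2_norm {ρ : Matrix (A × B) (A × B) ℂ} (hρ : IsState ρ) {γ : Matrix A A ℂ}
    (hγ : γ.PosSemidef) :
    Imin ρ γ = negLog2 ‖partialTraceA (supportProj ρ * (γ ⊗ₖ (1 : Matrix B B ℂ)))‖ := by
  have : Nonempty B := hρ.nonempty.map Prod.snd
  have hK := partialTraceA_posSemidef (supportProj_posSemidef ρ) hγ
  obtain ⟨σ, hσ, h⟩ := exists_isState_re_trace_mul_eq_norm hK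
  rw [trace_partialTraceA_mul] at h
  refine le_antisymm ((iInf₂_le σ hσ).trans_eq (by rw [Dmin, h])) (le_iInf₂ fun τ hτ => ?_)
  refine negLog2_antitone ?_
  rw [← trace_partialTraceA_mul]
  exact re_trace_mul_le_norm hK hτ

end Unsmoothed

/-! ### The trace distance to a pure state -/

section TraceDistance

variable {R : Type*} [Fintype R] [DecidableEq R]

/-- The operational bound on the trace norm: a measurement effect `P` sees a traceless `Z` by at
most half its trace norm. -/
lemma re_trace_mul_le_half_traceNorm {P Z : Matrix R R ℂ} (hP : P.PosSemidef)
    (hP' : (1 - P).PosSemidef) (hZ : Z.IsHermitian) (h0 : Z.trace = 0) :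
    (P * Z).trace.re ≤ (1 / 2) * traceNorm Z := by
  have hs : IsSelfAdjoint Z := hZ
  have h1 : (CFC.abs Z - Z).PosSemidef := by
    rw [← Matrix.nonneg_iff_posSemidef, CFC.abs_sub_self Z]
    exact smul_nonneg zero_le_two (CFC.negPart_nonneg Z)
  have h2 : (CFC.abs Z + Z).PosSemidef := by
    rw [← Matrix.nonneg_iff_posSemidef, CFC.abs_add_self Z]
    exact smul_nonneg zero_le_two (CFC.posPart_nonneg Z)
  -- `Tr[P Z] = (Tr[P Z] - Tr[(1 - P) Z]) / 2`, and `|Z| ± Z ≥ 0` bounds each term.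
  have h3 := re_trace_mul_nonneg hP h1
  have h4 := re_trace_mul_nonneg hP' h2
  simp only [Matrix.mul_sub, Matrix.mul_add, Matrix.sub_mul, Matrix.one_mul, Matrix.trace_sub,
    Matrix.trace_add, h0, Complex.sub_re, Complex.add_re, Complex.zero_re] at h3 h4
  rw [traceNorm]
  linarith

lemma traceNorm_eq_of_mul_self_eq {Z Y : Matrix R R ℂ} (hY : Y.PosSemidef)
    (h : Z.conjTranspose * Z = Y * Y) : traceNorm Z = Y.trace.re := by
  rw [traceNorm, CFC.abs, Matrix.star_eq_conjTranspose, h,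
    CFC.sqrt_mul_self Y (Matrix.nonneg_iff_posSemidef.mpr hY)]

/-- The uniform state on the orthogonal complement of the basis vector `s`. -/
noncomputable def complementState (s : R) : Matrix R R ℂ :=
  (((Fintype.card R : ℝ) - 1)⁻¹ : ℝ) • (1 - pureState s)

lemma isState_complementState (s : R) (h : 2 ≤ Fintype.card R) :
    IsState (complementState s) := by
  have h2 : (2 : ℝ) ≤ Fintype.card R := by exact_mod_cast h
  refine ⟨(one_sub_pureState_posSemidef s).smul (inv_nonneg.mpr (by linarith)), ?_⟩
  rw [complementState, Matrix.trace_smul, Matrix.trace_sub, Matrix.trace_one,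
    (isState_pureState s).2, Complex.real_smul]
  have : ((Fintype.card R : ℂ) - 1) ≠ 0 := by
    have : (Fintype.card R : ℝ) - 1 ≠ 0 := by linarith
    exact_mod_cast this
  push_cast
  exact inv_mul_cancel₀ this

lemma pureState_mul_self (s : R) : pureState s * pureState s = pureState s := by
  simp [pureState]

lemma pureState_mul_complementState (s : R) : pureState s * complementState s = 0 := by
  simp [complementState, Matrix.mul_sub, pureState_mul_self]

lemma complementState_mul_pureState (s : R) : complementState s * pureState s = 0 := by
  simp [complementState, Matrix.sub_mul, pureState_mul_self]

lemma traceDist_pureState_mix (s : R) (h : 2 ≤ Fintype.card R) {p : ℝ} (hp : p ≤ 1) :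
    traceDist (pureState s) (p • pureState s + (1 - p) • complementState s) = 1 - p := by
  have hψ := isState_pureState s
  have hτ := isState_complementState s h
  have e : pureState s - (p • pureState s + (1 - p) • complementState s) =
      (1 - p) • (pureState s - complementState s) := by
    module
  -- The two states are orthogonal, so `ψ - τ` and `ψ + τ` have the same square.
  have hn : traceNorm ((1 - p) • (pureState s - complementState s)) =
      ((1 - p) • (pureState s + complementState s)).trace.re := by
    refine traceNorm_eq_of_mul_self_eq ((hψ.1.add hτ.1).smul (sub_nonneg.mpr hp)) ?_
    rw [Matrix.conjTranspose_smul, Matrix.conjTranspose_sub, hψ.1.1.eq, hτ.1.1.eq]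
    simp [Matrix.mul_add, Matrix.mul_sub, Matrix.add_mul, Matrix.sub_mul,
      pureState_mul_complementState, complementState_mul_pureState]
  rw [traceDist, e, hn, Matrix.trace_smul, Matrix.trace_add, hψ.2, hτ.2]
  simp
  ring

end TraceDistance

/-! ### Channels -/

section Channels

variable {R S : Type*} [Fintype R] [Fintype S]

lemma IsChannel.posSemidef {N : Matrix R R ℂ →ₗ[ℂ] Matrix S S ℂ} (hN : IsChannel N)
    {X : Matrix R R ℂ} (hX : X.PosSemidef) : (N X).PosSemidef := by
  -- Positivity is complete positivity at an auxiliary system of dimension one.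
  have h := hN.1 1 (X.submatrix Prod.snd Prod.snd) (hX.submatrix _)
  exact h.submatrix (fun s : S => ((0 : Fin 1), s))

lemma IsChannel.isState {N : Matrix R R ℂ →ₗ[ℂ] Matrix S S ℂ} (hN : IsChannel N)
    {X : Matrix R R ℂ} (hX : IsState X) : IsState (N X) :=
  ⟨hN.posSemidef hX.1, by rw [hN.2, hX.2]⟩

/-- Complete positivity of the functional `X ↦ Tr[L X]`. -/
lemma blockTrace_posSemidef {K : Type*} [Fintype K] {L : Matrix R R ℂ} (hL : L.PosSemidef)
    {X : Matrix (K × R) (K × R) ℂ} (hX : X.PosSemidef) :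
    (Matrix.of fun i j : K =>
      (L * Matrix.of fun x y => X (i, x) (j, y)).trace).PosSemidef := by
  classical
  obtain ⟨C, rfl⟩ := exists_conjTranspose_mul_self hL
  -- `W a` is the Kraus operator `1 ⊗ ⟨a|C`.
  let W (a : R) : Matrix K (K × R) ℂ := Matrix.of fun i p => if p.1 = i then C a p.2 else 0
  have h : (Matrix.of fun i j : K =>
      (C.conjTranspose * C * Matrix.of fun x y => X (i, x) (j, y)).trace) =
      ∑ a, W a * X * (W a).conjTranspose := by
    ext i j
    rw [Matrix.of_apply, Matrix.mul_assoc, Matrix.trace_mul_comm, Matrix.sum_apply, Matrix.trace]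
    refine Finset.sum_congr rfl fun a _ => ?_
    simp [W, Matrix.mul_apply, Fintype.sum_prod_type, Finset.sum_ite_irrel, apply_ite]
  rw [h]
  exact Matrix.posSemidef_sum _ fun a _ => hX.mul_mul_conjTranspose_same _

/-- The measure-and-prepare map of the binary measurement `{L, 1 - L}`: it prepares `ψ` on the
outcome `L` and `τ` on the other one. -/
noncomputable def measurePrepare [DecidableEq R] (L : Matrix R R ℂ) (ψ τ : Matrix S S ℂ) :
    Matrix R R ℂ →ₗ[ℂ] Matrix S S ℂ where
  toFun X := (L * X).trace • ψ + ((1 - L) * X).trace • τ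
  map_add' X Y := by
    simp only [Matrix.mul_add, Matrix.trace_add, add_smul]; abel
  map_smul' c X := by
    simp only [Matrix.mul_smul, Matrix.trace_smul, smul_assoc, smul_add, RingHom.id_apply]

omit [Fintype S] in
lemma measurePrepare_apply [DecidableEq R] (L : Matrix R R ℂ) (ψ τ : Matrix S S ℂ)
    (X : Matrix R R ℂ) :
    measurePrepare L ψ τ X = (L * X).trace • ψ + ((1 - L) * X).trace • τ := rfl

lemma isChannel_measurePrepare [DecidableEq R] {L : Matrix R R ℂ} (hL : L.PosSemidef)
    (hL' : (1 - L).PosSemidef) {ψ τ : Matrix S S ℂ} (hψ : IsState ψ) (hτ : IsState τ) :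
    IsChannel (measurePrepare L ψ τ) := by
  classical
  refine ⟨fun k X hX => ?_, fun X => ?_⟩
  · have h := ((blockTrace_posSemidef hL hX).kronecker hψ.1).add
      ((blockTrace_posSemidef hL' hX).kronecker hτ.1)
    exact h
  · rw [measurePrepare_apply, Matrix.trace_add, Matrix.trace_smul, Matrix.trace_smul, hψ.2, hτ.2,
      Matrix.sub_mul, Matrix.one_mul, Matrix.trace_sub]
    simp

lemma isChannel_reindex (e : R ≃ S) :
    IsChannel (Matrix.reindexLinearEquiv ℂ ℂ e e : Matrix R R ℂ →ₗ[ℂ] Matrix S S ℂ) := by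
  refine ⟨fun k X hX => ?_, fun X => ?_⟩
  · exact hX.submatrix (fun i : Fin k × S => (i.1, e.symm i.2))
  · exact e.symm.sum_comp fun r => X r r

end Channels

/-! ### The battery -/

section Battery

variable {A B : Type*}

lemma kronecker_kronecker_eq_submatrix {K : Type*} (X : Matrix K K ℂ) (Y : Matrix A A ℂ)
    (Z : Matrix B B ℂ) : (X ⊗ₖ Y) ⊗ₖ Z =
      (X ⊗ₖ (Y ⊗ₖ Z)).submatrix (Equiv.prodAssoc _ _ _) (Equiv.prodAssoc _ _ _) := by
  ext; simp [mul_assoc]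

lemma withBattery_kronecker (n : ℕ) (X : Matrix A A ℂ) (Y : Matrix B B ℂ) :
    withBattery n (X ⊗ₖ Y) = (pureState (0 : Fin (n + 1)) ⊗ₖ X) ⊗ₖ Y :=
  (kronecker_kronecker_eq_submatrix _ X Y).symm

lemma withBattery_add (n : ℕ) (X Y : Matrix (A × B) (A × B) ℂ) :
    withBattery n (X + Y) = withBattery n X + withBattery n Y := by
  rw [withBattery, Matrix.kronecker_add]; rfl

lemma withBattery_smul (n : ℕ) (c : ℂ) (X : Matrix (A × B) (A × B) ℂ) :
    withBattery n (c • X) = c • withBattery n X := by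
  rw [withBattery, Matrix.kronecker_smul]; rfl

lemma pureState_kronecker_one {S : Type*} [DecidableEq S] (s : S) :
    pureState s ⊗ₖ (1 : Matrix Unit Unit ℂ) = pureState (s, ()) := by
  have : (1 : Matrix Unit Unit ℂ) = Matrix.single () () 1 := by ext; simp
  rw [this, pureState, pureState, Matrix.single_kronecker_single, mul_one]

variable [Fintype A] [Fintype B]

lemma withBattery_posSemidef (n : ℕ) {X : Matrix (A × B) (A × B) ℂ} (hX : X.PosSemidef) :
    (withBattery n X).PosSemidef := by
  classical
  exact ((isState_pureState _).1.kronecker hX).submatrix _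

lemma trace_submatrix_equiv {R S : Type*} [Fintype R] [Fintype S] (X : Matrix R R ℂ)
    (e : S ≃ R) : (X.submatrix e e).trace = X.trace :=
  e.sum_comp fun r => X r r

lemma trace_withBattery (n : ℕ) (X : Matrix (A × B) (A × B) ℂ) :
    (withBattery n X).trace = X.trace := by
  rw [withBattery, trace_submatrix_equiv, Matrix.trace_kronecker, (isState_pureState _).2, one_mul]

lemma isState_withBattery (n : ℕ) {ρ : Matrix (A × B) (A × B) ℂ} (hρ : IsState ρ) :
    IsState (withBattery n ρ) :=
  ⟨withBattery_posSemidef n hρ.1, by rw [trace_withBattery, hρ.2]⟩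

omit [Fintype A] in
lemma withBattery_pureState [DecidableEq A] (n : ℕ) (a₀ : A) :
    withBattery n (pureState a₀ ⊗ₖ (1 : Matrix Unit Unit ℂ)) =
      pureState (((0 : Fin (n + 1)), a₀), ()) := by
  rw [withBattery_kronecker, ← pureState_kronecker_one, pureState, pureState,
    Matrix.single_kronecker_single, mul_one, pureState]

end Battery

/-! ### Lower bound on the work cost -/

section Converse

/-- A positive functional dominated by the trace is represented by a measurement effect. -/
lemma exists_trace_mul_eq {R : Type*} [Fintype R] [DecidableEq R] (φ : Matrix R R ℂ →ₗ[ℂ] ℂ)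
    (h0 : ∀ X : Matrix R R ℂ, X.PosSemidef → 0 ≤ φ X)
    (h1 : ∀ X : Matrix R R ℂ, X.PosSemidef → φ X ≤ X.trace) :
    ∃ Λ : Matrix R R ℂ, Λ.PosSemidef ∧ (1 - Λ).PosSemidef ∧ ∀ X, (Λ * X).trace = φ X := by
  have key (X : Matrix R R ℂ) :
      ((Matrix.of fun i j => φ (Matrix.single j i 1)) * X).trace = φ X := by
    conv_rhs => rw [Matrix.matrix_eq_sum_single X]
    simp only [map_sum, Matrix.trace, Matrix.diag, Matrix.mul_apply, Matrix.of_apply]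
    rw [Finset.sum_comm]
    refine Finset.sum_congr rfl fun i _ => Finset.sum_congr rfl fun j _ => ?_
    rw [← mul_one (X i j), ← smul_eq_mul (X i j), ← Matrix.smul_single, map_smul, smul_eq_mul,
      smul_eq_mul, mul_one, mul_comm]
  refine ⟨_, posSemidef_of_trace_mul_nonneg fun X hX => ?_,
    posSemidef_of_trace_mul_nonneg fun X hX => ?_, key⟩
  · rw [key]; exact h0 X hX
  · rw [Matrix.sub_mul, Matrix.trace_sub, key, Matrix.one_mul]
    exact sub_nonneg.mpr (h1 X hX)

variable {A B A' : Type*} [Fintype A] [Fintype B] [Fintype A']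

/-- If Bob's final system is trivial, a free operation sends `γ ⊗ σ` to `γ'` for every state `σ` of
Bob: his channel merely replaces `σ` by another state. -/
lemma IsFreeOperation.map_kronecker
    {N : Matrix (A × B) (A × B) ℂ →ₗ[ℂ] Matrix (A' × Unit) (A' × Unit) ℂ}
    {γ : Matrix A A ℂ} {γ' : Matrix A' A' ℂ} (hN : IsFreeOperation N γ γ')
    {σ : Matrix B B ℂ} (hσ : IsState σ) : N (γ ⊗ₖ σ) = γ' ⊗ₖ (1 : Matrix Unit Unit ℂ) := by
  obtain ⟨-, d, E, F, hE, hF, hNF, hγ⟩ := hN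
  have hs : IsState ((E σ).submatrix (fun x : Fin d => ((), x)) (fun x => ((), x))) := by
    refine ⟨(hE.isState hσ).1.submatrix _, ?_⟩
    rw [← (hE.isState hσ).2]
    simp [Matrix.trace, Fintype.sum_prod_type]
  have h := hγ _ hs
  rw [hNF, ← h]
  have hE' (a a' : A) : E (Matrix.of fun x y => (γ ⊗ₖ σ) (a, x) (a', y)) = γ a a' • E σ := by
    rw [← map_smul]; rfl
  ext ⟨a, u⟩ ⟨a', u'⟩
  simp only [Matrix.submatrix_apply, ampl, Matrix.of_apply, Prod.swap_prod_mk, hE']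
  rw [Matrix.kroneckerMap_apply, Matrix.one_apply_eq, mul_one]
  rfl

lemma uniformState_kronecker (A B : Type*) [Fintype A] [DecidableEq A] [Fintype B]
    [DecidableEq B] : uniformState A ⊗ₖ uniformState B = uniformState (A × B) := by
  simp only [uniformState, Matrix.smul_kronecker, Matrix.kronecker_smul, Matrix.one_kronecker_one,
    smul_smul, Fintype.card_prod, Nat.cast_mul, mul_inv, mul_comm]

variable [DecidableEq A] [DecidableEq B]

/-- The battery states of an erasure protocol of error at most `ε` bound the information from below.
Pulling the target effect back through the protocol gives a test for `ρ`; since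
`|0⟩⟨0| ≤ (n₀ + 1) π` on the battery, it accepts `γ ⊗ σ` with at most `n₀ + 1` times the weight of
the target in the uniform output state. -/
lemma negLog2_le_smoothImin {ε : ℝ} {ρ : Matrix (A × B) (A × B) ℂ} (hρ : IsState ρ)
    {γ : Matrix A A ℂ} (hγ : IsState γ) (a₀ : A) {n₀ n₁ : ℕ}
    {N : Matrix ((Fin (n₀ + 1) × A) × B) ((Fin (n₀ + 1) × A) × B) ℂ →ₗ[ℂ]
        Matrix ((Fin (n₁ + 1) × A) × Unit) ((Fin (n₁ + 1) × A) × Unit) ℂ}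
    (hN : IsFreeOperation N (uniformState (Fin (n₀ + 1)) ⊗ₖ γ)
        (uniformState (Fin (n₁ + 1)) ⊗ₖ uniformState A))
    (hd : traceDist (withBattery n₁ (pureState a₀ ⊗ₖ (1 : Matrix Unit Unit ℂ)))
      (N (withBattery n₀ ρ)) ≤ ε) :
    negLog2 (((n₀ : ℝ) + 1) / (((n₁ : ℝ) + 1) * Fintype.card A)) ≤ smoothImin ε ρ γ := by
  rw [withBattery_pureState] at hd
  set s : (Fin (n₁ + 1) × A) × Unit := ((0, a₀), ())
  have hψ := isState_pureState s
  have hψ' := one_sub_pureState_posSemidef s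
  let φ : Matrix (A × B) (A × B) ℂ →ₗ[ℂ] ℂ :=
    { toFun := fun X => (pureState s * N (withBattery n₀ X)).trace
      map_add' := fun X Y => by
        rw [withBattery_add, map_add, Matrix.mul_add, Matrix.trace_add]
      map_smul' := fun c X => by
        rw [withBattery_smul, map_smul, Matrix.mul_smul, Matrix.trace_smul]; rfl }
  have hpos {X} (hX : X.PosSemidef) : (N (withBattery n₀ X)).PosSemidef :=
    hN.1.posSemidef (withBattery_posSemidef n₀ hX)
  obtain ⟨Λ, hΛ, hΛ', hφ⟩ := exists_trace_mul_eq φ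
    (fun X hX => trace_mul_nonneg hψ.1 (hpos hX))
    (fun X hX => by
      have := trace_mul_nonneg hψ' (hpos hX)
      rw [Matrix.sub_mul, Matrix.trace_sub, Matrix.one_mul, hN.1.2, trace_withBattery] at this
      exact sub_nonneg.mp this)
  have hT : IsTest ε ρ Λ := by
    refine ⟨hΛ, hΛ', ?_⟩
    have hω := hN.1.isState (isState_withBattery n₀ hρ)
    have h := re_trace_mul_le_half_traceNorm hψ.1 hψ' (hψ.1.1.sub hω.1.1)
      (by rw [Matrix.trace_sub, hψ.2, hω.2, sub_self])
    rw [Matrix.mul_sub, pureState_mul_self, Matrix.trace_sub, hψ.2, Complex.sub_re,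
      Complex.one_re] at h
    have h2 := h.trans hd
    rw [hφ]
    change 1 - ε ≤ (pureState s * N (withBattery n₀ ρ)).trace.re
    linarith
  refine le_iInf₂ fun σ hσ => le_trans (negLog2_antitone ?_)
    (le_iSup₂ (f := fun (Λ : Matrix (A × B) (A × B) ℂ) (_ : IsTest ε ρ Λ) =>
      negLog2 (Λ * (γ ⊗ₖ σ)).trace.re) Λ hT)
  have hn : ((n₀ : ℂ) + 1) ≠ 0 := by exact_mod_cast n₀.succ_ne_zero
  -- `|0⟩⟨0| ≤ (n₀ + 1) π`, transported through the positive map `N`.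
  have hsub : (N ((((n₀ : ℂ) + 1) • (uniformState (Fin (n₀ + 1)) ⊗ₖ γ)) ⊗ₖ σ -
      withBattery n₀ (γ ⊗ₖ σ))).PosSemidef := by
    refine hN.1.posSemidef ?_
    have h := ((one_sub_pureState_posSemidef (0 : Fin (n₀ + 1))).kronecker hγ.1).kronecker hσ.1
    have hu : ((n₀ : ℂ) + 1) • uniformState (Fin (n₀ + 1)) = 1 := by
      rw [uniformState, Fintype.card_fin, Nat.cast_succ, smul_smul, mul_inv_cancel₀ hn, one_smul]
    rw [withBattery_kronecker, ← Matrix.smul_kronecker, hu]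
    have e : ((1 - pureState (0 : Fin (n₀ + 1))) ⊗ₖ γ) ⊗ₖ σ =
        (1 ⊗ₖ γ) ⊗ₖ σ - (pureState (0 : Fin (n₀ + 1)) ⊗ₖ γ) ⊗ₖ σ := by
      ext; simp [sub_mul]
    rwa [← e]
  have h := re_trace_mul_nonneg hψ.1 hsub
  rw [map_sub, Matrix.smul_kronecker, map_smul, hN.map_kronecker hσ, Matrix.mul_sub,
    Matrix.trace_sub, Matrix.mul_smul, Matrix.trace_smul, uniformState_kronecker] at h
  have hu : uniformState (Fin (n₁ + 1) × A) ⊗ₖ (1 : Matrix Unit Unit ℂ) =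
      (Fintype.card (Fin (n₁ + 1) × A) : ℂ)⁻¹ • 1 := by
    rw [uniformState, Matrix.smul_kronecker, Matrix.one_kronecker_one]
  rw [hu, Matrix.mul_smul, Matrix.mul_one, Matrix.trace_smul, hψ.2, Complex.sub_re] at h
  rw [hφ]
  change (pureState s * N (withBattery n₀ (γ ⊗ₖ σ))).trace.re ≤ _
  have hval : (((n₀ : ℂ) + 1) • (Fintype.card (Fin (n₁ + 1) × A) : ℂ)⁻¹ • (1 : ℂ)).re =
      ((n₀ : ℝ) + 1) / (((n₁ : ℝ) + 1) * Fintype.card A) := by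
    rw [← Complex.ofReal_re (((n₀ : ℝ) + 1) / (((n₁ : ℝ) + 1) * Fintype.card A))]
    congr 1
    simp [div_eq_mul_inv]
  rw [hval] at h
  linarith

end Converse

/-! ### A free operation built from a test -/

section Achievability

variable {A B A' : Type*} [Fintype A] [Fintype B] [Fintype A']
  [DecidableEq A] [DecidableEq B] [DecidableEq A']

lemma trace_submatrix_mul {R S : Type*} [Fintype R] [Fintype S] (L : Matrix R R ℂ)
    (X : Matrix S S ℂ) (e : S ≃ R) :
    (L.submatrix e e * X).trace = (L * X.submatrix e.symm e.symm).trace := by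
  rw [← trace_submatrix_equiv _ e, ← Matrix.submatrix_mul_equiv _ _ e e e]
  simp

omit [DecidableEq A'] in
/-- A measure-and-prepare channel on `AB` is a free operation as soon as it is Gibbs-preserving for
every state of `B`: Bob sends all of `B` to Alice. -/
lemma isFreeOperation_measurePrepare {L : Matrix (A × B) (A × B) ℂ} (hL : L.PosSemidef)
    (hL' : (1 - L).PosSemidef) {ψ τ : Matrix A' A' ℂ} (hψ : IsState ψ) (hτ : IsState τ)
    {γ : Matrix A A ℂ} {γ' : Matrix A' A' ℂ}
    (h : ∀ σ : Matrix B B ℂ, IsState σ → measurePrepare L ψ τ (γ ⊗ₖ σ) = γ') :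
    IsFreeOperation (measurePrepare L (ψ ⊗ₖ (1 : Matrix Unit Unit ℂ)) (τ ⊗ₖ 1)) γ γ' := by
  have h1 : IsState (1 : Matrix Unit Unit ℂ) := ⟨Matrix.PosSemidef.one, by simp⟩
  let e : B ≃ Fin (Fintype.card B) := Fintype.equivFin B
  let f : A × Fin (Fintype.card B) ≃ A × B := (Equiv.refl A).prodCongr e.symm
  let e' : B ≃ Unit × Fin (Fintype.card B) := e.trans (Equiv.punitProd _).symm
  have hsub : 1 - L.submatrix f f = (1 - L).submatrix f f := by
    rw [Matrix.submatrix_sub, Pi.sub_apply, Pi.sub_apply, Matrix.submatrix_one_equiv]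
  have hF (X) : measurePrepare (L.submatrix f f) ψ τ X =
      measurePrepare L ψ τ (X.submatrix f.symm f.symm) := by
    rw [measurePrepare_apply, measurePrepare_apply, hsub, trace_submatrix_mul,
      trace_submatrix_mul]
  refine ⟨isChannel_measurePrepare hL hL' (isState_kronecker hψ h1) (isState_kronecker hτ h1),
    Fintype.card B, (Matrix.reindexLinearEquiv ℂ ℂ e' e').toLinearMap,
    measurePrepare (L.submatrix f f) ψ τ, isChannel_reindex e',
    isChannel_measurePrepare (hL.submatrix f) (by rw [hsub]; exact hL'.submatrix f) hψ hτ,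
    fun X => ?_, fun σ hσ => ?_⟩
  · ext ⟨a, u⟩ ⟨a', u'⟩
    simp only [Matrix.submatrix_apply, Prod.swap_prod_mk, ampl, Matrix.of_apply, hF]
    have hX : (Matrix.of fun x y : A × Fin (Fintype.card B) =>
        (Matrix.reindexLinearEquiv ℂ ℂ e' e').toLinearMap
          (Matrix.of fun p q => X (x.1, p) (y.1, q)) (u, x.2) (u', y.2)).submatrix f.symm f.symm
        = X := by
      ext p q
      simp [f, e']
    rw [hX]
    simp [measurePrepare_apply]
  · rw [hF]
    refine h (σ.submatrix e e) ⟨hσ.1.submatrix e, ?_⟩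
    rw [trace_submatrix_equiv, hσ.2]

/-- The effect `|0⟩⟨0| ⊗ Λ + (1 - |0⟩⟨0|) ⊗ 1 ⊗ M` on battery, `A` and `B`: the test `Λ` if the
battery is in its initial state, and otherwise the effect `M` on Bob's system alone. -/
noncomputable def batteryTest (n : ℕ) (Λ : Matrix (A × B) (A × B) ℂ) (M : Matrix B B ℂ) :
    Matrix ((Fin (n + 1) × A) × B) ((Fin (n + 1) × A) × B) ℂ :=
  withBattery n Λ + ((1 - pureState (0 : Fin (n + 1))) ⊗ₖ (1 : Matrix A A ℂ)) ⊗ₖ M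

omit [DecidableEq B] in
lemma batteryTest_posSemidef (n : ℕ) {Λ : Matrix (A × B) (A × B) ℂ} {M : Matrix B B ℂ}
    (hΛ : Λ.PosSemidef) (hM : M.PosSemidef) : (batteryTest n Λ M).PosSemidef :=
  (withBattery_posSemidef n hΛ).add
    (((one_sub_pureState_posSemidef _).kronecker Matrix.PosSemidef.one).kronecker hM)

omit [Fintype A] [Fintype B] in
lemma one_sub_batteryTest (n : ℕ) (Λ : Matrix (A × B) (A × B) ℂ) (M : Matrix B B ℂ) :
    1 - batteryTest n Λ M = batteryTest n (1 - Λ) (1 - M) := by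
  have h (X : Matrix (Fin (n + 1)) (Fin (n + 1)) ℂ) :
      ((X ⊗ₖ (1 : Matrix A A ℂ)) ⊗ₖ (1 - M)) = (X ⊗ₖ 1) ⊗ₖ 1 - (X ⊗ₖ 1) ⊗ₖ M := by
    ext; simp [mul_sub]
  have h2 : withBattery n (1 - Λ) = withBattery n 1 - withBattery n Λ := by
    rw [sub_eq_add_neg, ← neg_one_smul ℂ Λ, withBattery_add, withBattery_smul]
    simp [sub_eq_add_neg]
  have h3 : (1 : Matrix ((Fin (n + 1) × A) × B) ((Fin (n + 1) × A) × B) ℂ) =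
      withBattery n 1 + ((1 - pureState (0 : Fin (n + 1))) ⊗ₖ (1 : Matrix A A ℂ)) ⊗ₖ 1 := by
    rw [← Matrix.one_kronecker_one (m := A) (n := B), withBattery_kronecker,
      ← Matrix.add_kronecker, ← Matrix.add_kronecker, add_sub_cancel, Matrix.one_kronecker_one,
      Matrix.one_kronecker_one]
  rw [batteryTest, batteryTest, h, h2]
  nth_rw 1 [h3]
  abel

omit [DecidableEq B] in
lemma trace_batteryTest_mul_withBattery (n : ℕ) (Λ ρ : Matrix (A × B) (A × B) ℂ)
    (M : Matrix B B ℂ) :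
    (batteryTest n Λ M * withBattery n ρ).trace = (Λ * ρ).trace := by
  have h1 : withBattery n Λ * withBattery n ρ = withBattery n (Λ * ρ) := by
    rw [withBattery, withBattery, Matrix.submatrix_mul_equiv,
      ← Matrix.mul_kronecker_mul, pureState_mul_self]; rfl
  have h2 : (((1 - pureState (0 : Fin (n + 1))) ⊗ₖ (1 : Matrix A A ℂ)) ⊗ₖ M) *
      withBattery n ρ = 0 := by
    rw [kronecker_kronecker_eq_submatrix, withBattery, Matrix.submatrix_mul_equiv,
      ← Matrix.mul_kronecker_mul, Matrix.sub_mul, Matrix.one_mul, pureState_mul_self, sub_self,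
      Matrix.zero_kronecker]
    rfl
  rw [batteryTest, Matrix.add_mul, h1, h2, add_zero, trace_withBattery]

omit [DecidableEq B] in
/-- On Gibbs states, `M` contributes a term that can compensate the dependence of
`Tr[Λ (γ ⊗ σ)]` on `σ`. -/
lemma trace_batteryTest_mul_thermal (n : ℕ) (Λ : Matrix (A × B) (A × B) ℂ)
    (M : Matrix B B ℂ) {γ : Matrix A A ℂ} (hγ : γ.trace = 1) (σ : Matrix B B ℂ) :
    (batteryTest n Λ M * ((uniformState (Fin (n + 1)) ⊗ₖ γ) ⊗ₖ σ)).trace =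
      ((n : ℂ) + 1)⁻¹ * ((Λ * (γ ⊗ₖ σ)).trace + n * (M * σ).trace) := by
  -- Split the uniform battery state into `|0⟩⟨0|` and its complement.
  have e : ((uniformState (Fin (n + 1)) ⊗ₖ γ) ⊗ₖ σ) = ((n : ℂ) + 1)⁻¹ •
      (withBattery n (γ ⊗ₖ σ) + ((1 - pureState (0 : Fin (n + 1))) ⊗ₖ γ) ⊗ₖ σ) := by
    rw [withBattery_kronecker, ← Matrix.add_kronecker, ← Matrix.add_kronecker, add_sub_cancel,
      uniformState, Matrix.smul_kronecker, Matrix.smul_kronecker]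
    simp
  have h2 : (withBattery n Λ * (((1 - pureState (0 : Fin (n + 1))) ⊗ₖ γ) ⊗ₖ σ)).trace = 0 := by
    rw [kronecker_kronecker_eq_submatrix, withBattery, Matrix.submatrix_mul_equiv,
      ← Matrix.mul_kronecker_mul, Matrix.mul_sub, Matrix.mul_one, pureState_mul_self, sub_self,
      Matrix.zero_kronecker]
    simp
  have h3 : ((((1 - pureState (0 : Fin (n + 1))) ⊗ₖ (1 : Matrix A A ℂ)) ⊗ₖ M) *
      (((1 - pureState (0 : Fin (n + 1))) ⊗ₖ γ) ⊗ₖ σ)).trace = n * (M * σ).trace := by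
    have hi : (1 - pureState (0 : Fin (n + 1))) * (1 - pureState (0 : Fin (n + 1))) =
        (1 - pureState (0 : Fin (n + 1))) := by
      simp [Matrix.sub_mul, Matrix.mul_sub, pureState_mul_self]
    rw [← Matrix.mul_kronecker_mul, ← Matrix.mul_kronecker_mul, Matrix.trace_kronecker,
      Matrix.trace_kronecker, hi, Matrix.one_mul, hγ, Matrix.trace_sub, (isState_pureState _).2]
    simp
  rw [e, Matrix.mul_smul, Matrix.trace_smul, Matrix.mul_add, Matrix.trace_add,
    trace_batteryTest_mul_withBattery, batteryTest, Matrix.add_mul, Matrix.trace_add, h2, h3,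
    zero_add, smul_eq_mul]

lemma mix_pureState_complementState {R : Type*} [Fintype R] [DecidableEq R] (s : R)
    (h : 2 ≤ Fintype.card R) :
    (Fintype.card R : ℂ)⁻¹ • pureState s + (1 - (Fintype.card R : ℂ)⁻¹) • complementState s =
      uniformState R := by
  have h2 : (2 : ℝ) ≤ Fintype.card R := by exact_mod_cast h
  have h3 : (Fintype.card R : ℂ) ≠ 0 := by
    have : (Fintype.card R : ℝ) ≠ 0 := by linarith
    exact_mod_cast this
  have h4 : (Fintype.card R : ℂ) - 1 ≠ 0 := by
    have : (Fintype.card R : ℝ) - 1 ≠ 0 := by linarith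
    exact_mod_cast this
  have h5 : complementState s = ((Fintype.card R : ℂ) - 1)⁻¹ • (1 - pureState s) := by
    rw [complementState]
    ext i j
    simp
  rw [h5, uniformState, smul_smul]
  have h6 : (1 - (Fintype.card R : ℂ)⁻¹) * ((Fintype.card R : ℂ) - 1)⁻¹ =
      (Fintype.card R : ℂ)⁻¹ := by
    field_simp
  rw [h6, ← smul_add, add_sub_cancel]

end Achievability

/-! ### The work cost of erasure -/

section Erasure

variable {A B : Type*} [Fintype A] [DecidableEq A] [Fintype B] [DecidableEq B]

lemma complementState_kronecker_one {S : Type*} [Fintype S] [DecidableEq S] (s : S) :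
    complementState s ⊗ₖ (1 : Matrix Unit Unit ℂ) = complementState (s, ()) := by
  have h : (1 - pureState s) ⊗ₖ (1 : Matrix Unit Unit ℂ) = 1 - pureState (s, ()) := by
    rw [← pureState_kronecker_one, ← Matrix.one_kronecker_one]
    ext i j; simp [Matrix.one_apply, Prod.ext_iff]
  rw [complementState, complementState, Matrix.smul_kronecker, h, Fintype.card_prod,
    Fintype.card_unit, mul_one]

/-- A test `Λ` yields an erasure protocol: prepare the target state when `batteryTest n₀ Λ M`
accepts, and otherwise the uniform state on its complement. Gibbs preservation requires the
acceptance probability on `π ⊗ γ ⊗ σ` to be `1 / |A₁ A|` for every `σ`, which determines `M`; the bound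
on the norm is the condition `0 ≤ M`. -/
lemma exists_isFreeOperation_traceDist_le {ε : ℝ} {ρ : Matrix (A × B) (A × B) ℂ}
    (hρ : IsState ρ) {γ : Matrix A A ℂ} (hγ : IsState γ) (a₀ : A)
    {Λ : Matrix (A × B) (A × B) ℂ} (hΛ : IsTest ε ρ Λ) {n₀ n₁ : ℕ} (hn₀ : 1 ≤ n₀) (hn₁ : 1 ≤ n₁)
    (hK : ‖partialTraceA (Λ * (γ ⊗ₖ (1 : Matrix B B ℂ)))‖ ≤
      ((n₀ : ℝ) + 1) / (((n₁ : ℝ) + 1) * Fintype.card A)) :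
    ∃ N : Matrix ((Fin (n₀ + 1) × A) × B) ((Fin (n₀ + 1) × A) × B) ℂ →ₗ[ℂ]
        Matrix ((Fin (n₁ + 1) × A) × Unit) ((Fin (n₁ + 1) × A) × Unit) ℂ,
      IsFreeOperation N (uniformState (Fin (n₀ + 1)) ⊗ₖ γ)
        (uniformState (Fin (n₁ + 1)) ⊗ₖ uniformState A) ∧
      traceDist (withBattery n₁ (pureState a₀ ⊗ₖ (1 : Matrix Unit Unit ℂ)))
        (N (withBattery n₀ ρ)) ≤ ε := by
  have hcA : 1 ≤ Fintype.card A := Fintype.card_pos_iff.mpr ⟨a₀⟩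
  set S := Fin (n₁ + 1) × A
  set s : S := (0, a₀)
  have hcS : Fintype.card S = (n₁ + 1) * Fintype.card A := by simp [S]
  have hS : 2 ≤ Fintype.card S := by rw [hcS]; nlinarith
  set K := partialTraceA (Λ * (γ ⊗ₖ (1 : Matrix B B ℂ))) with hKdef
  have hKp : K.PosSemidef := partialTraceA_posSemidef hΛ.1 hγ.1
  set r : ℝ := ((n₀ : ℝ) + 1) / Fintype.card S with hr
  have hS' : (2 : ℝ) ≤ Fintype.card S := by exact_mod_cast hS
  have hn : (1 : ℝ) ≤ n₀ := by exact_mod_cast hn₀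
  have hr0 : 0 ≤ r := by positivity
  -- This gives `M ≤ 1`, and it is where `n₀ ≥ 1` and `|A₁ A| ≥ 2` are used.
  have hrn : r ≤ n₀ := by
    rw [hr, div_le_iff₀ (by linarith)]
    nlinarith
  have hKr : ‖K‖ ≤ r := by
    refine hK.trans_eq ?_
    rw [hr, hcS]; push_cast; rfl
  -- The solution of `(Tr[Λ (γ ⊗ σ)] + n₀ Tr[M σ]) / (n₀ + 1) = 1 / |A₁ A|` for all states `σ`.
  let M : Matrix B B ℂ := ((n₀ : ℝ)⁻¹) • ((r : ℂ) • (1 : Matrix B B ℂ) - K)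
  have hM : M.PosSemidef :=
    ((norm_le_iff_posSemidef hKp hr0).mp hKr).smul (inv_nonneg.mpr (by linarith))
  have hM' : (1 - M).PosSemidef := by
    have e : 1 - M = ((n₀ : ℝ)⁻¹) • ((n₀ - r : ℝ) • (1 : Matrix B B ℂ) + K) := by
      have h1 : (1 : Matrix B B ℂ) = ((n₀ : ℝ)⁻¹) • (n₀ : ℝ) • (1 : Matrix B B ℂ) := by
        rw [smul_smul, inv_mul_cancel₀ (by linarith), one_smul]
      have h2 : (r : ℂ) • (1 : Matrix B B ℂ) = r • (1 : Matrix B B ℂ) := by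
        ext; simp
      simp only [M]
      nth_rw 1 [h1]
      rw [h2, ← smul_sub, sub_smul]
      congr 1
      abel
    rw [e]
    exact ((Matrix.PosSemidef.one.smul (sub_nonneg.mpr hrn)).add hKp).smul
      (inv_nonneg.mpr (by linarith))
  have hL := batteryTest_posSemidef n₀ hΛ.1 hM
  have hL' : (1 - batteryTest n₀ Λ M).PosSemidef := by
    rw [one_sub_batteryTest]
    exact batteryTest_posSemidef n₀ hΛ.2.1 hM'
  have hψ := isState_pureState s
  have hτ := isState_complementState s hS
  have hn0 : (n₀ : ℂ) ≠ 0 := by exact_mod_cast (by omega : n₀ ≠ 0)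
  have hn1 : (n₀ : ℂ) + 1 ≠ 0 := by exact_mod_cast n₀.succ_ne_zero
  have hone (X : Matrix ((Fin (n₀ + 1) × A) × B) ((Fin (n₀ + 1) × A) × B) ℂ) :
      ((1 - batteryTest n₀ Λ M) * X).trace = X.trace - (batteryTest n₀ Λ M * X).trace := by
    rw [Matrix.sub_mul, Matrix.trace_sub, Matrix.one_mul]
  refine ⟨_, isFreeOperation_measurePrepare hL hL' hψ hτ fun σ hσ => ?_, ?_⟩
  · have hMσ : (M * σ).trace = (n₀ : ℂ)⁻¹ * (r - (Λ * (γ ⊗ₖ σ)).trace) := by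
      rw [← trace_partialTraceA_mul Λ γ σ, ← hKdef]
      simp [M, Matrix.sub_mul, Matrix.trace_sub, hσ.2]
    have hc : (batteryTest n₀ Λ M * ((uniformState (Fin (n₀ + 1)) ⊗ₖ γ) ⊗ₖ σ)).trace =
        (Fintype.card S : ℂ)⁻¹ := by
      rw [trace_batteryTest_mul_thermal n₀ Λ M hγ.2 σ, hMσ, mul_inv_cancel_left₀ hn0,
        add_sub_cancel, hr]
      push_cast
      rw [mul_div_assoc', inv_mul_cancel₀ hn1, one_div]
    have ht : ((uniformState (Fin (n₀ + 1)) ⊗ₖ γ) ⊗ₖ σ).trace = 1 := by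
      rw [Matrix.trace_kronecker, Matrix.trace_kronecker, hγ.2, hσ.2, uniformState,
        Matrix.trace_smul, Matrix.trace_one, Fintype.card_fin, Nat.cast_succ, smul_eq_mul,
        inv_mul_cancel₀ hn1, one_mul, one_mul]
    rw [measurePrepare_apply, hone, hc, ht, mix_pureState_complementState s hS,
      uniformState_kronecker]
  · have hp : (Λ * ρ).trace.re ≤ 1 := by
      have := re_trace_mul_nonneg hΛ.2.1 hρ.1
      rw [Matrix.sub_mul, Matrix.trace_sub, Matrix.one_mul, hρ.2, Complex.sub_re,
        Complex.one_re] at this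
      linarith
    have hS1 : 2 ≤ Fintype.card (S × Unit) := by simpa using hS
    have e (p : ℝ) (X : Matrix (S × Unit) (S × Unit) ℂ) : (p : ℂ) • X = p • X := by
      ext; simp
    have hd := traceDist_pureState_mix (s, ()) hS1 hp
    rw [withBattery_pureState, measurePrepare_apply, hone, trace_batteryTest_mul_withBattery,
      trace_withBattery, hρ.2, trace_eq_re hΛ.1 hρ.1, ← Complex.ofReal_one, ← Complex.ofReal_sub,
      e, e, pureState_kronecker_one, complementState_kronecker_one, hd]
    linarith [hΛ.2.2]

/-- Ratios of battery dimensions, both at least two, are dense from above. -/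
lemma exists_nat_ratio {t x : ℝ} (ht : 0 ≤ t) (hx : t < x) :
    ∃ n₀ n₁ : ℕ, 1 ≤ n₀ ∧ 1 ≤ n₁ ∧ t ≤ ((n₀ : ℝ) + 1) / ((n₁ : ℝ) + 1) ∧
      ((n₀ : ℝ) + 1) / ((n₁ : ℝ) + 1) ≤ x := by
  have hx0 : 0 < x := ht.trans_lt hx
  obtain ⟨k, hk⟩ := exists_nat_ge (max (2 / x) (1 / (x - t)))
  have h1 : 2 ≤ x * k := by
    have := (le_max_left _ _).trans hk
    rw [div_le_iff₀ hx0] at this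
    linarith
  have h2 : 1 ≤ (x - t) * k := by
    have := (le_max_right _ _).trans hk
    rw [div_le_iff₀ (sub_pos.mpr hx)] at this
    linarith
  have hX : 2 ≤ x * ((k : ℝ) + 1 + 1) := by nlinarith
  have hf : 2 ≤ ⌊x * ((k : ℝ) + 1 + 1)⌋₊ := Nat.le_floor (by exact_mod_cast hX)
  -- The dimensions are `n₁ + 1 = k + 2` and `n₀ + 1 = ⌊x (k + 2)⌋`, for large `k`.
  obtain ⟨n₀, hn₀⟩ : ∃ n₀, ⌊x * ((k : ℝ) + 1 + 1)⌋₊ = n₀ + 1 :=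
    ⟨_, (Nat.sub_add_cancel (by omega)).symm⟩
  have hle := Nat.floor_le (a := x * ((k : ℝ) + 1 + 1)) (by linarith)
  have hlt := Nat.lt_floor_add_one (x * ((k : ℝ) + 1 + 1))
  rw [hn₀] at hle hlt
  push_cast at hle hlt
  refine ⟨n₀, k + 1, by omega, by omega, ?_, ?_⟩
  · rw [le_div_iff₀ (by positivity)]
    push_cast
    nlinarith
  · rw [div_le_iff₀ (by positivity)]
    push_cast
    exact hle

lemma erasureCost_eq {β ε : ℝ} (hε : 0 ≤ ε) {ρ : Matrix (A × B) (A × B) ℂ} (hρ : IsState ρ)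
    {γ : Matrix A A ℂ} (hγ : IsState γ) (a₀ : A) :
    erasureCost β ε ρ γ a₀ = ((1 / β : ℝ) : EReal) *
      (((Real.logb 2 (Fintype.card A) : ℝ) : EReal) - smoothImin ε ρ γ) := by
  have hcA : (0 : ℝ) < Fintype.card A := by exact_mod_cast Fintype.card_pos_iff.mpr ⟨a₀⟩
  rw [erasureCost, workCost]
  congr 1
  refine le_antisymm ?_ ?_
  · obtain ⟨Λ, hΛ, hI, -⟩ := exists_isTest_smoothImin_eq hε hρ hγ.1
    set t := ‖partialTraceA (Λ * (γ ⊗ₖ (1 : Matrix B B ℂ)))‖ with ht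
    have ht0 : 0 ≤ t := norm_nonneg _
    -- Compare with the reals `y` above the right-hand side; this covers the value `⊥`, which occurs
    -- when `t = 0`.
    refine EReal.le_of_forall_lt_iff_le.mp fun y hy => ?_
    have hlt : t * Fintype.card A < 2 ^ y := by
      rcases ht0.eq_or_lt with h0 | h0
      · rw [← h0, zero_mul]; positivity
      · rw [hI, negLog2, if_neg h0.not_ge] at hy
        have hy' : Real.logb 2 (Fintype.card A) - -Real.logb 2 t < y := by exact_mod_cast hy
        rw [← Real.logb_lt_iff_lt_rpow one_lt_two (by positivity),
          Real.logb_mul h0.ne' hcA.ne']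
        linarith
    obtain ⟨n₀, n₁, hn₀, hn₁, h1, h2⟩ := exists_nat_ratio (by positivity) hlt
    obtain ⟨N, hN, hd⟩ := exists_isFreeOperation_traceDist_le hρ hγ a₀ hΛ hn₀ hn₁ (by
      rw [← div_div, le_div_iff₀ hcA]; exact h1)
    refine (iInf_le_of_le n₀ <| iInf_le_of_le n₁ <| iInf_le_of_le N <| iInf_le_of_le hN <|
      iInf_le_of_le hd le_rfl).trans ?_
    rw [EReal.coe_le_coe_iff, ← Real.logb_div (by positivity) (by positivity),
      Real.logb_le_iff_le_rpow one_lt_two (by positivity)]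
    exact h2
  · refine le_iInf fun n₀ => le_iInf fun n₁ => le_iInf fun N => le_iInf fun hN =>
      le_iInf fun hd => ?_
    have h := negLog2_le_smoothImin hρ hγ a₀ hN hd
    have hpos : 0 < ((n₀ : ℝ) + 1) / (((n₁ : ℝ) + 1) * Fintype.card A) := by positivity
    rw [negLog2, if_neg hpos.not_ge] at h
    refine (EReal.sub_le_sub le_rfl h).trans_eq ?_
    rw [← EReal.coe_sub, Real.logb_div (by positivity) (by positivity),
      Real.logb_mul (by positivity) (by positivity)]
    congr 1
    ring

end Erasure
end CondAthermality

theorem theorem4 {A B : Type*} [Fintype A] [DecidableEq A] [Fintype B] [DecidableEq B]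
    (β : ℝ) (hβ : 0 < β)
    (ρ : Matrix (A × B) (A × B) ℂ) (hρ : IsState ρ)
    (γ : Matrix A A ℂ) (hγ : IsState γ) (a₀ : A) :
    (∀ ε : ℝ, 0 ≤ ε → ε ≤ 1 →
      erasureCost β ε ρ γ a₀ =
          ((1 / β : ℝ) : EReal) *
            (((Real.logb 2 (Fintype.card A) : ℝ) : EReal) - smoothImin ε ρ γ) ∧
      smoothImin ε ρ γ =
          ⨆ (Λ : Matrix (A × B) (A × B) ℂ) (_ : IsTest ε ρ Λ),
            negLog2 ‖partialTraceA (Λ * (γ ⊗ₖ (1 : Matrix B B ℂ)))‖) ∧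
    (erasureCost β 0 ρ γ a₀ =
        ((1 / β : ℝ) : EReal) *
          (((Real.logb 2 (Fintype.card A) : ℝ) : EReal) - Imin ρ γ) ∧
      Imin ρ γ = negLog2 ‖partialTraceA (supportProj ρ * (γ ⊗ₖ (1 : Matrix B B ℂ)))‖) := by
  refine ⟨fun ε hε _ => ⟨erasureCost_eq hε hρ hγ a₀, ?_⟩, ?_, Imin_eq_negLog2_norm hρ hγ.1⟩
  · obtain ⟨_, _, _, h⟩ := exists_isTest_smoothImin_eq hε hρ hγ.1
    exact h
  · rw [← smoothImin_zero hρ hγ.1]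
    exact erasureCost_eq le_rfl hρ hγ a₀
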